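/- Let $G$ be a discrete group acting from the left on a set $S$. Let $\mathbb I\subseteq S$ contain exactly one point of each $G$-orbit, so that $S=\coprod_{x\in\mathbb I}\mathrm{Orb}_x$, and for $x\in\mathbb I$ let $H_x=\mathrm{Stab}_G(x)$. Regard $\ell^1(S)$ as a Banach bimodule over the convolution algebra $\ell^1(G)$, with left action induced by the $G$-action on $S$ ($e_g\cdot e_s=e_{g\cdot s}$) and with right action the augmentation action ($e_s\cdot e_g=e_s$), and give the dual $\ell^1(S)'$ the dual bimodule structure $(a\cdot\varphi)(m)=\varphi(m\cdot a)$, $(\varphi\cdot a)(m)=\varphi(a\cdot m)$. Assume that each stabilizer subgroup $H_x$, $x\in\mathbb I$, is amenable, i.e. that there is a left-invariant mean on $\ell^\infty(H_x)$. Then \[ H^n(\ell^1(G),\ell^1(S)')=0\qquad\text{for all } n\ge 1. \] Here, for a Banach algebra $A$ and a Banach $A$-bimodule $M$, $H^n(A,M)$ denotes the $n$th (continuous) Hochschild cohomology group, i.e. the quotient of the kernel of $\partial: C^n(A,M)\to C^{n+1}(A,M)$ by the range of $\partial: C^{n-1}(A,M)\to C^n(A,M)$, where $C^n(A,M)$ is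 the space of bounded $n$-linear maps from $A$ to $M$ and \[ (\partial\psi)(a_1,\dots,a_{n+1})=a_1\psi(a_2,\dots,a_{n+1})+\sum_{j=1}^n(-1)^j\psi(a_1,\dots,a_ja_{j+1},\dots,a_{n+1})+(-1)^{n+1}\psi(a_1,\dots,a_n)a_{n+1}. \] -/

import Mathlib

open scoped ENNReal

noncomputable section

/-! ### The Banach space `ℓ¹(ι)` and its universal property -/

/-- The Banach space `ℓ¹(ι)` of absolutely summable complex functions on a set `ι`. -/
abbrev EllOne (ι : Type*) : Type _ := lp (fun _ : ι => ℂ) 1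

namespace EllOne

variable {ι : Type*} {E : Type*} [NormedAddCommGroup E] [NormedSpace ℂ E] [CompleteSpace E]

open Classical in
/-- The standard basis vector `e_i` of `ℓ¹(ι)`. -/
def basisVec (i : ι) : EllOne ι := lp.single 1 i (1 : ℂ)

theorem norm_basisVec (i : ι) : ‖basisVec i‖ = 1 := by
  classical
  simp [basisVec, lp.norm_single]

theorem hasSum_norm (f : EllOne ι) : HasSum (fun i => ‖f i‖) ‖f‖ := by
  simpa using lp.hasSum_norm (p := 1) (by simp) f

theorem hasSum_basisVec (f : EllOne ι) : HasSum (fun i => f i • basisVec i) f := by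
  classical
  have h := lp.hasSum_single (p := 1) (by simp) f
  have e : (fun i => f i • basisVec i) = fun i => lp.single 1 i (f i) := by
    funext i
    rw [basisVec, ← lp.single_smul]
    simp
  rwa [e]

theorem norm_apply_smul_le {E : Type*} [NormedAddCommGroup E] [NormedSpace ℂ E] {v : ι → E}
    (hv : ∀ i, ‖v i‖ ≤ 1) (f : EllOne ι) (i : ι) : ‖f i • v i‖ ≤ ‖f i‖ := by
  rw [norm_smul]
  exact mul_le_of_le_one_right (norm_nonneg _) (hv i)

theorem summable_smul {v : ι → E} (hv : ∀ i, ‖v i‖ ≤ 1) (f : EllOne ι) :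
    Summable fun i => f i • v i :=
  Summable.of_norm_bounded (hasSum_norm f).summable (norm_apply_smul_le hv f)

/-- The contractive linear map `ℓ¹(ι) → E`, `f ↦ ∑ᵢ f(i) vᵢ`, sending each `e_i` to `v i`, for a
family `v` in the unit ball of a Banach space `E`. -/
def lift (v : ι → E) (hv : ∀ i, ‖v i‖ ≤ 1) : EllOne ι →L[ℂ] E :=
  LinearMap.mkContinuous
    { toFun := fun f => ∑' i, f i • v i
      map_add' := fun f g => by
        rw [← (summable_smul hv f).tsum_add (summable_smul hv g)]
        simp [add_smul]
      map_smul' := fun c f => by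
        rw [RingHom.id_apply, ← (summable_smul hv f).tsum_const_smul c]
        simp [mul_smul] }
    1 (fun f => by
      rw [one_mul]
      exact tsum_of_norm_bounded (hasSum_norm f) (norm_apply_smul_le hv f))

theorem lift_apply (v : ι → E) (hv : ∀ i, ‖v i‖ ≤ 1) (f : EllOne ι) :
    lift v hv f = ∑' i, f i • v i := rfl

theorem norm_lift_le (v : ι → E) (hv : ∀ i, ‖v i‖ ≤ 1) : ‖lift v hv‖ ≤ 1 :=
  LinearMap.mkContinuous_norm_le _ zero_le_one _

@[simp]
theorem lift_basisVec (v : ι → E) (hv : ∀ i, ‖v i‖ ≤ 1) (i : ι) :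
    lift v hv (basisVec i) = v i := by
  classical
  rw [lift_apply, tsum_eq_single i]
  · simp [basisVec]
  · intro j hj
    simp [basisVec, Pi.single_eq_of_ne hj]

/-- Continuous linear maps on `ℓ¹(ι)` are determined by their values on the basis vectors. -/
theorem clm_ext {F : Type*} [NormedAddCommGroup F] [NormedSpace ℂ F] {S T : EllOne ι →L[ℂ] F}
    (h : ∀ i, S (basisVec i) = T (basisVec i)) : S = T := by
  ext1 f
  have hS := (hasSum_basisVec f).mapL S
  have hT := (hasSum_basisVec f).mapL T
  simp only [map_smul, h] at hS hT
  exact hS.unique hT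

/-! ### The convolution algebra `ℓ¹(G)` and its action on `ℓ¹(S)` -/

variable {G : Type*} [Group G] {S : Type*} [MulAction G S]

/-- Translation by `g` on `ℓ¹(S)`, determined by `e_s ↦ e_{g • s}`. -/
def translate (S : Type*) [MulAction G S] (g : G) : EllOne S →L[ℂ] EllOne S :=
  lift (fun s => basisVec (g • s)) (fun _ => (norm_basisVec _).le)

theorem norm_translate_le (g : G) : ‖translate S g‖ ≤ 1 := norm_lift_le _ _

/-- The action of `ℓ¹(G)` on `ℓ¹(S)` induced by the action of `G` on `S`: it is the bounded bilinear
map determined by `(e_g, e_s) ↦ e_{g • s}`. -/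
def act (G S : Type*) [Group G] [MulAction G S] : EllOne G →L[ℂ] EllOne S →L[ℂ] EllOne S :=
  lift (translate S) norm_translate_le

theorem act_basisVec_basisVec (g : G) (s : S) :
    act G S (basisVec g) (basisVec s) = basisVec (g • s) := by
  rw [act, lift_basisVec]
  exact lift_basisVec _ _ s

/-- The action of `ℓ¹(G)` on `ℓ¹(S)` is given by the usual convolution formula. -/
theorem act_apply (f : EllOne G) (u : EllOne S) (s : S) :
    act G S f u s = ∑' g, f g * u (g⁻¹ • s) := by
  classical
  have ht (g : G) (s : S) : translate S g u s = u (g⁻¹ • s) := by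
    have h : (lp.evalCLM ℂ (fun _ : S => ℂ) 1 s).comp (translate S g) =
        lp.evalCLM ℂ (fun _ : S => ℂ) 1 (g⁻¹ • s) := by
      refine clm_ext fun t => ?_
      have e : translate S g (basisVec t) = basisVec (g • t) := lift_basisVec _ _ t
      rw [ContinuousLinearMap.comp_apply, e]
      change (Pi.single (g • t) (1 : ℂ) : S → ℂ) s = (Pi.single t (1 : ℂ) : S → ℂ) (g⁻¹ • s)
      simp [Pi.single_apply, inv_smul_eq_iff]
    exact congrArg (fun T => T u) h
  have h := ((summable_smul (v := translate S) norm_translate_le f).hasSum.mapL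
    (ContinuousLinearMap.apply ℂ _ u)).mapL (lp.evalCLM ℂ (fun _ : S => ℂ) 1 s)
  rw [← lift_apply (hv := norm_translate_le)] at h
  refine h.tsum_eq.symm.trans (tsum_congr fun g => ?_)
  rw [← ht]
  rfl

theorem norm_act_le (f : EllOne G) (u : EllOne S) : ‖act G S f u‖ ≤ ‖f‖ * ‖u‖ := by
  refine (ContinuousLinearMap.le_opNorm₂ _ _ _).trans ?_
  have : ‖act G S‖ ≤ 1 := norm_lift_le _ _
  gcongr
  exact mul_le_of_le_one_left (norm_nonneg _) this

theorem act_act (f g : EllOne G) (u : EllOne S) :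
    act G S (act G G f g) u = act G S f (act G S g u) := by
  have h₁ (x y : G) : (act G S (act G G (basisVec x) (basisVec y))) =
      (act G S (basisVec x)).comp (act G S (basisVec y)) :=
    clm_ext fun s => by simp [act_basisVec_basisVec, mul_smul]
  have h₂ (x : G) : ((act G S).flip u).comp (act G G (basisVec x)) =
      (act G S (basisVec x)).comp ((act G S).flip u) :=
    clm_ext fun y => congrArg (fun T => T u) (h₁ x y)
  have h₃ : ((act G S).flip u).comp ((act G G).flip g) = (act G S).flip (act G S g u) :=
    clm_ext fun x => congrArg (fun T => T g) (h₂ x)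
  exact congrArg (fun T => T f) h₃

theorem act_one (u : EllOne S) : act G S (basisVec 1) u = u := by
  have h : act G S (basisVec 1) = ContinuousLinearMap.id ℂ _ :=
    clm_ext fun s => by simp [act_basisVec_basisVec]
  rw [h]; rfl

theorem act_basisVec_one (f : EllOne G) : act G G f (basisVec 1) = f := by
  have h : (act G G).flip (basisVec 1) = ContinuousLinearMap.id ℂ _ :=
    clm_ext fun s => by simp [act_basisVec_basisVec]
  exact congrArg (fun T => T f) h

/-- `ℓ¹(G)` is a unital Banach algebra under convolution, the bounded bilinear product determined by
`e_g * e_h = e_{gh}`, with unit `e_1`. -/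
instance instNormedRing : NormedRing (EllOne G) where
  __ := (inferInstance : NormedAddCommGroup (EllOne G))
  mul f g := act G G f g
  one := basisVec 1
  left_distrib f g h := map_add _ _ _
  right_distrib f g h := by
    change act G G (f + g) h = act G G f h + act G G g h
    simp
  zero_mul f := by
    change act G G 0 f = 0
    simp
  mul_zero f := map_zero _
  mul_assoc f g h := act_act f g h
  one_mul f := act_one f
  mul_one f := act_basisVec_one f
  norm_mul_le f g := norm_act_le f g

theorem mul_def (f g : EllOne G) : f * g = act G G f g := rfl

instance instNormedAlgebra : NormedAlgebra ℂ (EllOne G) where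
  __ := Algebra.ofModule (R := ℂ) (A := EllOne G)
    (fun c f g => by simp [mul_def]) (fun c f g => by simp [mul_def])
  norm_smul_le c f := _root_.norm_smul_le c f

/-- The augmentation character `ε : ℓ¹(G) → ℂ`, `f ↦ ∑ g, f g`, sending each `e_g` to `1`. -/
def augmentation (G : Type*) : EllOne G →L[ℂ] ℂ := lift (fun _ => 1) (fun _ => by simp)

theorem augmentation_basisVec {G : Type*} (g : G) : augmentation G (basisVec g) = 1 :=
  lift_basisVec _ _ g

theorem augmentation_mul (f g : EllOne G) :
    augmentation G (f * g) = augmentation G f * augmentation G g := by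
  have h₁ (x : G) : (augmentation G).comp (act G G (basisVec x)) = augmentation G :=
    clm_ext fun y => by simp [act_basisVec_basisVec, augmentation_basisVec]
  have h₂ : (augmentation G).comp ((act G G).flip g) = augmentation G g • augmentation G :=
    clm_ext fun x => (congrArg (fun T => T g) (h₁ x)).trans (by simp [augmentation_basisVec])
  exact (congrArg (fun T => T f) h₂).trans (mul_comm _ _)

end EllOne

/-! ### Banach bimodules and their duals -/

section Bimodule

variable (A : Type*) [NormedRing A] [NormedAlgebra ℂ A]
  (M : Type*) [NormedAddCommGroup M] [NormedSpace ℂ M]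

/-- A Banach `A`-bimodule structure on a Banach space `M`: commuting left and right actions of `A`
on `M` which are jointly continuous, i.e. bounded bilinear maps (not necessarily contractive).
Here `left a m` is `a · m` and `right a m` is `m · a`. -/
structure BanachBimodule where
  left : A →L[ℂ] M →L[ℂ] M
  right : A →L[ℂ] M →L[ℂ] M
  left_mul : ∀ a b m, left (a * b) m = left a (left b m)
  right_mul : ∀ a b m, right (a * b) m = right b (right a m)
  left_right : ∀ a b m, left a (right b m) = right b (left a m)

variable {A M}

/-- The dual bimodule `M'`, with actions the adjoints of the actions on `M`:
`(a · φ)(m) = φ(m · a)` and `(φ · a)(m) = φ(a · m)`. -/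
def BanachBimodule.dual (X : BanachBimodule A M) : BanachBimodule A (M →L[ℂ] ℂ) where
  left := (ContinuousLinearMap.compL ℂ M M ℂ).flip.comp X.right
  right := (ContinuousLinearMap.compL ℂ M M ℂ).flip.comp X.left
  left_mul a b φ := by ext m; simp [X.right_mul]
  right_mul a b φ := by ext m; simp [X.left_mul]
  left_right a b φ := by ext m; simp [X.left_right]

theorem BanachBimodule.dual_left_apply (X : BanachBimodule A M) (a : A) (φ : M →L[ℂ] ℂ) (m : M) :
    X.dual.left a φ m = φ (X.right a m) := rfl

theorem BanachBimodule.dual_right_apply (X : BanachBimodule A M) (a : A) (φ : M →L[ℂ] ℂ) (m : M) :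
    X.dual.right a φ m = φ (X.left a m) := rfl

end Bimodule

/-- For a group `G` acting on a set `S`, the Banach `ℓ¹(G)`-bimodule `ℓ¹(S)` with left action
induced by the action of `G` on `S` and right action the augmentation action `u · f = ε(f) u`. -/
def EllOne.bimodule (G S : Type*) [Group G] [MulAction G S] :
    BanachBimodule (EllOne G) (EllOne S) where
  left := EllOne.act G S
  right := (EllOne.augmentation G).smulRight (ContinuousLinearMap.id ℂ (EllOne S))
  left_mul f g u := EllOne.act_act f g u
  right_mul f g u := by
    simp [EllOne.augmentation_mul, smul_smul]
  left_right f g u := by simp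

/-! ### Hochschild cohomology -/

section Hochschild

variable {A : Type*} [NormedRing A] [NormedAlgebra ℂ A]
  {M : Type*} [NormedAddCommGroup M] [NormedSpace ℂ M]

variable (A M) in
/-- The space `Cⁿ(A, M)` of bounded `n`-linear maps from `A` to `M`. -/
abbrev HochschildCochain (n : ℕ) : Type _ :=
  ContinuousMultilinearMap ℂ (fun _ : Fin n => A) M

/-- The tuple `(a₀, …, aⱼ aⱼ₊₁, …, aₙ)` of length `n`. -/
def mulAdjacent {n : ℕ} (j : Fin n) (a : Fin (n + 1) → A) : Fin n → A :=
  fun k => if k < j then a k.castSucc else if k = j then a k.castSucc * a k.succ else a k.succ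

theorem exists_mulAdjacent_update {n : ℕ} (j : Fin n) (a : Fin (n + 1) → A) (i : Fin (n + 1)) :
    ∃ (k : Fin n) (φ : A →ₗ[ℂ] A), ∀ [DecidableEq (Fin (n + 1))] (x : A),
      mulAdjacent j (Function.update a i x) = Function.update (mulAdjacent j a) k (φ x) := by
  rcases lt_trichotomy i j.castSucc with h | h | h
  · refine ⟨⟨i, by grind⟩, LinearMap.id, fun x => ?_⟩
    funext k
    simp only [mulAdjacent, Function.update_apply, LinearMap.id_apply]
    grind
  · refine ⟨j, LinearMap.mulRight ℂ (a j.succ), fun x => ?_⟩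
    funext k
    simp only [mulAdjacent, Function.update_apply, LinearMap.mulRight_apply]
    grind
  · by_cases h' : i = j.succ
    · refine ⟨j, LinearMap.mulLeft ℂ (a j.castSucc), fun x => ?_⟩
      funext k
      simp only [mulAdjacent, Function.update_apply, LinearMap.mulLeft_apply]
      grind
    · refine ⟨i.pred (by grind), LinearMap.id, fun x => ?_⟩
      funext k
      simp only [mulAdjacent, Function.update_apply, LinearMap.id_apply]
      grind

/-- The map `(a₀, …, aₙ) ↦ ψ(a₀, …, aⱼ aⱼ₊₁, …, aₙ)` for an `n`-cochain `ψ`. -/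
def HochschildCochain.mulFace {n : ℕ} (j : Fin n) (ψ : HochschildCochain A M n) :
    HochschildCochain A M (n + 1) where
  toFun a := ψ (mulAdjacent j a)
  map_update_add' a i x y := by
    obtain ⟨k, φ, h⟩ := exists_mulAdjacent_update j a i
    simp [h]
  map_update_smul' a i c x := by
    obtain ⟨k, φ, h⟩ := exists_mulAdjacent_update j a i
    simp [h]
  cont := by
    refine ψ.cont.comp (continuous_pi fun k => ?_)
    unfold mulAdjacent
    split_ifs <;> fun_prop

theorem HochschildCochain.mulFace_apply {n : ℕ} (j : Fin n) (ψ : HochschildCochain A M n)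
    (a : Fin (n + 1) → A) : ψ.mulFace j a = ψ (mulAdjacent j a) := rfl

/-- The map `(a₀, …, aₙ) ↦ a₀ · ψ(a₁, …, aₙ)` for an `n`-cochain `ψ`. -/
def HochschildCochain.leftFace (X : BanachBimodule A M) {n : ℕ} (ψ : HochschildCochain A M n) :
    HochschildCochain A M (n + 1) :=
  ContinuousLinearMap.uncurryLeft
    (((ContinuousLinearMap.compContinuousMultilinearMapL ℂ (fun _ : Fin n => A) M M).flip ψ).comp
      X.left)

theorem HochschildCochain.leftFace_apply (X : BanachBimodule A M) {n : ℕ}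
    (ψ : HochschildCochain A M n) (a : Fin (n + 1) → A) :
    ψ.leftFace X a = X.left (a 0) (ψ fun i => a i.succ) := rfl

/-- The map `(a₀, …, aₙ) ↦ ψ(a₀, …, aₙ₋₁) · aₙ` for an `n`-cochain `ψ`. -/
def HochschildCochain.rightFace (X : BanachBimodule A M) {n : ℕ} (ψ : HochschildCochain A M n) :
    HochschildCochain A M (n + 1) :=
  ContinuousMultilinearMap.uncurryRight (X.right.flip.compContinuousMultilinearMap ψ)

theorem HochschildCochain.rightFace_apply (X : BanachBimodule A M) {n : ℕ}
    (ψ : HochschildCochain A M n) (a : Fin (n + 1) → A) :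
    ψ.rightFace X a = X.right (a (Fin.last n)) (ψ fun i => a i.castSucc) := rfl

/-- The Hochschild coboundary operator `Cⁿ(A, M) → Cⁿ⁺¹(A, M)`. -/
def hochschildD (X : BanachBimodule A M) (n : ℕ) :
    HochschildCochain A M n →ₗ[ℂ] HochschildCochain A M (n + 1) where
  toFun ψ := ψ.leftFace X + ∑ j : Fin n, (-1 : ℂ) ^ ((j : ℕ) + 1) • ψ.mulFace j
    + (-1 : ℂ) ^ (n + 1) • ψ.rightFace X
  map_add' φ ψ := by
    ext a
    simp only [add_apply, smul_apply,
      sum_apply, HochschildCochain.leftFace_apply,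
      HochschildCochain.mulFace_apply, HochschildCochain.rightFace_apply, map_add, smul_add,
      Finset.sum_add_distrib]
    abel
  map_smul' c ψ := by
    ext a
    simp only [add_apply, smul_apply,
      sum_apply, HochschildCochain.leftFace_apply,
      HochschildCochain.mulFace_apply, HochschildCochain.rightFace_apply, map_smul, smul_add,
      Finset.smul_sum, RingHom.id_apply, smul_comm c]

/-- The Hochschild coboundary formula, with the arguments numbered from `0` to `n`. -/
theorem hochschildD_apply (X : BanachBimodule A M) (n : ℕ) (ψ : HochschildCochain A M n)
    (a : Fin (n + 1) → A) :
    hochschildD X n ψ a = X.left (a 0) (ψ fun i => a i.succ)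
      + ∑ j : Fin n, (-1 : ℂ) ^ ((j : ℕ) + 1) • ψ (mulAdjacent j a)
      + (-1 : ℂ) ^ (n + 1) • X.right (a (Fin.last n)) (ψ fun i => a i.castSucc) := by
  simp only [hochschildD, LinearMap.coe_mk, AddHom.coe_mk, add_apply,
    smul_apply, sum_apply,
    HochschildCochain.leftFace_apply, HochschildCochain.mulFace_apply,
    HochschildCochain.rightFace_apply]

/-- The `k`th coface map, `0 ≤ k ≤ n + 1`, whose alternating sum is the coboundary. -/
def HochschildCochain.face (X : BanachBimodule A M) {n : ℕ} (k : ℕ) (ψ : HochschildCochain A M n) :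
    HochschildCochain A M (n + 1) :=
  if k = 0 then ψ.leftFace X else if h : k - 1 < n then ψ.mulFace ⟨k - 1, h⟩ else ψ.rightFace X

theorem HochschildCochain.face_apply (X : BanachBimodule A M) {n : ℕ} (k : ℕ)
    (ψ : HochschildCochain A M n) (a : Fin (n + 1) → A) :
    ψ.face X k a = if k = 0 then X.left (a 0) (ψ fun i => a i.succ) else
      if h : k - 1 < n then ψ (mulAdjacent ⟨k - 1, h⟩ a) else
        X.right (a (Fin.last n)) (ψ fun i => a i.castSucc) := by
  unfold face
  split_ifs <;> rfl

theorem hochschildD_eq_sum (X : BanachBimodule A M) (n : ℕ) (ψ : HochschildCochain A M n) :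
    hochschildD X n ψ = ∑ k ∈ Finset.range (n + 2), (-1 : ℂ) ^ k • ψ.face X k := by
  rw [Finset.sum_range_succ, Finset.sum_range_succ', Finset.sum_range]
  simp [HochschildCochain.face, hochschildD]
  abel

theorem HochschildCochain.face_face (X : BanachBimodule A M) {n : ℕ} (ψ : HochschildCochain A M n)
    (k l : ℕ) (hkl : k < l) (hl : l ≤ n + 2) :
    (ψ.face X k).face X l = (ψ.face X (l - 1)).face X k := by
  ext a
  simp only [face_apply]
  rcases Nat.eq_zero_or_pos k with rfl | hk
  · rcases (show l = 1 ∨ (2 ≤ l ∧ l ≤ n + 1) ∨ l = n + 2 by omega) with rfl | ⟨h1, h2⟩ | rfl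
    · simp [mulAdjacent, X.left_mul]
    · rw [if_neg (by omega), dif_pos (by omega), if_pos rfl, if_pos rfl, if_neg (by omega),
        dif_pos (by omega)]
      congr 2
      · simp only [mulAdjacent]; grind [Fin.castSucc_zero]
      · funext i
        simp only [mulAdjacent]; grind
    · rw [if_neg (by omega), dif_neg (by omega), if_pos rfl, if_pos rfl, if_neg (by omega),
        dif_neg (by omega), X.left_right]
      rfl
  · by_cases hl' : l = n + 2
    · subst hl'
      by_cases hk' : k = n + 1
      · subst hk'
        rw [if_neg (by omega), dif_neg (by omega), if_neg (by omega), dif_neg (by omega),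
          if_neg (by omega), dif_pos (by omega), if_neg (by omega), dif_neg (by omega),
          ← X.right_mul]
        congr 2
        · simp only [mulAdjacent]; grind
        · funext i
          simp only [mulAdjacent]; grind
      · rw [if_neg (by omega), dif_neg (by omega), if_neg (by omega), dif_pos (by omega),
          if_neg (by omega), dif_pos (by omega), if_neg (by omega), dif_neg (by omega)]
        congr 2
        · simp only [mulAdjacent]; grind
        · funext i
          simp only [mulAdjacent]; grind
    · rw [if_neg (by omega), dif_pos (by omega), if_neg (by omega), dif_pos (by omega),
        if_neg (by omega), dif_pos (by omega), if_neg (by omega), dif_pos (by omega)]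
      congr 1
      funext i
      simp only [mulAdjacent]
      grind [mul_assoc]

theorem hochschild_alternating_sum_eq_zero {N : Type*} [AddCommGroup N] [Module ℂ N] (n : ℕ) (T : ℕ → ℕ → N)
    (h : ∀ k l, k < l → l ≤ n + 2 → T l k = T k (l - 1)) :
    ∑ p ∈ Finset.range (n + 3) ×ˢ Finset.range (n + 2), (-1 : ℂ) ^ (p.1 + p.2) • T p.1 p.2 = 0 := by
  refine Finset.sum_involution
    (fun p _ => if p.2 < p.1 then (p.2, p.1 - 1) else (p.2 + 1, p.1)) ?_ ?_ ?_ ?_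
  · rintro ⟨l, k⟩ hp
    simp only [Finset.mem_product, Finset.mem_range] at hp
    dsimp only
    split_ifs with hkl
    · rw [h k l hkl (by omega)]
      obtain ⟨m, rfl⟩ : ∃ m, l = m + 1 := ⟨l - 1, by omega⟩
      simp only [Nat.add_sub_cancel]
      rw [← add_smul]
      convert zero_smul ℂ _
      ring
    · rw [h l (k + 1) (by omega) (by omega)]
      simp only [Nat.add_sub_cancel]
      rw [← add_smul]
      convert zero_smul ℂ _
      ring
  · rintro ⟨l, k⟩ hp _
    dsimp only
    split_ifs <;> simp <;> omega
  · rintro ⟨l, k⟩ hp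
    simp only [Finset.mem_product, Finset.mem_range] at hp ⊢
    split_ifs <;> simp <;> omega
  · rintro ⟨l, k⟩ hp
    dsimp only
    split_ifs with h1 h2 h2 <;> simp at * <;> omega

/-- The Hochschild cochain complex is a complex. -/
theorem hochschildD_hochschildD (X : BanachBimodule A M) (n : ℕ) (ψ : HochschildCochain A M n) :
    hochschildD X (n + 1) (hochschildD X n ψ) = 0 := by
  have h := hochschild_alternating_sum_eq_zero n (fun l k => (ψ.face X k).face X l)
    (fun k l hkl hl => ψ.face_face X k l hkl hl)
  rw [← h, Finset.sum_product_right, hochschildD_eq_sum X n, map_sum]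
  refine Finset.sum_congr rfl fun k _ => ?_
  rw [map_smul, hochschildD_eq_sum, Finset.smul_sum]
  refine Finset.sum_congr rfl fun l _ => ?_
  rw [smul_smul, ← pow_add, add_comm k l]

/-- The space `Zⁿ(A, M)` of `n`-cocycles. -/
def hochschildCocycles (X : BanachBimodule A M) (n : ℕ) : Submodule ℂ (HochschildCochain A M n) :=
  LinearMap.ker (hochschildD X n)

/-- The space `Bⁿ(A, M)` of `n`-coboundaries; it is zero for `n = 0`. -/
def hochschildCoboundaries (X : BanachBimodule A M) :
    (n : ℕ) → Submodule ℂ (HochschildCochain A M n)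
  | 0 => ⊥
  | n + 1 => LinearMap.range (hochschildD X n)

/-- The `n`th Hochschild cohomology group `Hⁿ(A, M) = Zⁿ(A, M) / Bⁿ(A, M)`. -/
abbrev HochschildCohomology (X : BanachBimodule A M) (n : ℕ) : Type _ :=
  hochschildCocycles X n ⧸ (hochschildCoboundaries X n).submoduleOf (hochschildCocycles X n)

end Hochschild

/-! ### Amenability -/

/-- Left translation `(h · f)(x) = f(h⁻¹ x)` of a bounded function on a group. -/
def ellInftyTranslate {H : Type*} [Group H] (h : H) (f : lp (fun _ : H => ℂ) ∞) :
    lp (fun _ : H => ℂ) ∞ :=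
  ⟨fun x => f (h⁻¹ * x), by
    refine memℓp_infty ?_
    obtain ⟨C, hC⟩ := (lp.memℓp f).bddAbove
    exact ⟨C, by rintro _ ⟨x, rfl⟩; exact hC ⟨h⁻¹ * x, rfl⟩⟩⟩

/-- A discrete group `H` is amenable if there is a left-invariant mean on `ℓ^∞(H)`, that is, a
functional `m` with `‖m‖ = m(1) = 1` and `m(h · f) = m(f)` for all `h` and `f`. -/
def IsAmenableGroup (H : Type*) [Group H] : Prop :=
  ∃ m : lp (fun _ : H => ℂ) ∞ →L[ℂ] ℂ, ‖m‖ = 1 ∧ m 1 = 1 ∧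
    ∀ (h : H) (f : lp (fun _ : H => ℂ) ∞), m (ellInftyTranslate h f) = m f

end

noncomputable section

/-! ### Averaging over cosets of the stabilizers. -/

namespace EllOne

/-! Write `A = ℓ¹(G)`, `M = ℓ¹(S)'`, and let `L(A, M)` carry the actions `(a · T)(k) = a · T(k)` and
`(T · a)(k) = T(ak)`. The bimodule map `φ ↦ (k ↦ φ · k)` embeds `M` in `L(A, M)`. A bounded bimodule
retraction `R` of this embedding kills cohomology in positive degrees: a cocycle `f` becomes `L(A,
M)`-valued once its last argument is left free, and applying `R` to its cocycle identity exhibits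
`f` as a coboundary (`hochschildCocycles_le_range`).

Amenability supplies `R` (`exists_averaging_operator`). For `s = t • x` with `x ∈ I`, the elements
`k` with `k • x = s` form the coset `t H_x`, and `(R T)(e_s)` is the mean of `T(e_k)(e_x)` over that
coset. Invariance of the mean removes the choice of `t`, which makes `R` equivariant on the right.
For `T = (k ↦ φ · k)` the averaged function is constantly `φ(e_s)`, so `R` is a retraction. The left
action on `M` is by scalars, so left compatibility is just linearity. -/

/-- Bounded linear maps `ℓ¹(ι) → ℓ¹(κ)'`. -/
abbrev ToDual (ι κ : Type*) : Type _ := EllOne ι →L[ℂ] EllOne κ →L[ℂ] ℂ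

instance ToDual.instNormedAddCommGroup {ι κ : Type*} : NormedAddCommGroup (ToDual ι κ) :=
  ContinuousLinearMap.toNormedAddCommGroup

instance ToDual.instNormedSpace {ι κ : Type*} : NormedSpace ℂ (ToDual ι κ) :=
  ContinuousLinearMap.toNormedSpace

variable {G S : Type*} [Group G]

/-- The bounded function `h ↦ T(e_{t h})(e_x)` on a subgroup `H` of `G`. -/
def cosetSample (H : Subgroup G) (t : G) (x : S) :
    ToDual G S →L[ℂ] lp (fun _ : H => ℂ) ∞ :=
  have bound (T : ToDual G S) (h : H) :
      ‖T (basisVec (t * h)) (basisVec x)‖ ≤ ‖T‖ := by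
    simpa [norm_basisVec] using T.le_opNorm₂ (basisVec (t * h)) (basisVec x)
  LinearMap.mkContinuous
    { toFun := fun T => ⟨fun h => T (basisVec (t * h)) (basisVec x),
        memℓp_infty ⟨‖T‖, by rintro _ ⟨h, rfl⟩; exact bound T h⟩⟩
      map_add' := fun _ _ => rfl
      map_smul' := fun _ _ => rfl }
    1 (fun T => by
      rw [one_mul]
      exact lp.norm_le_of_forall_le (norm_nonneg _) (bound T))

theorem cosetSample_apply (H : Subgroup G) (t : G) (x : S)
    (T : ToDual G S) (h : H) :
    cosetSample H t x T h = T (basisVec (t * h)) (basisVec x) := rfl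

theorem norm_cosetSample_le (H : Subgroup G) (t : G) (x : S) : ‖cosetSample H t x‖ ≤ 1 := by
  unfold cosetSample
  exact LinearMap.mkContinuous_norm_le _ zero_le_one _

/-- Changing the coset representative is a left translation of the sample, so an invariant mean does
not see it. -/
theorem cosetSample_mul (H : Subgroup G) (t : G) (k : H) (x : S)
    (T : ToDual G S) :
    cosetSample H (t * k) x T = ellInftyTranslate k⁻¹ (cosetSample H t x T) := by
  ext h
  change T (basisVec (t * k * h)) (basisVec x) = T (basisVec (t * ↑(k⁻¹⁻¹ * h))) (basisVec x)
  simp [mul_assoc]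

variable [MulAction G S]

/-- If all stabilizers are amenable, there is a `G`-equivariant family of averages
`T ↦ ∫ T(e_k)(e_{k⁻¹ s}) dμ_s(k)` indexed by the points `s` of `S`. -/
theorem exists_equivariant_averages (I : Set S)
    (hI : ∀ s : S, ∃! x : S, x ∈ I ∧ s ∈ MulAction.orbit G x)
    (hamen : ∀ x ∈ I, IsAmenableGroup (MulAction.stabilizer G x)) :
    ∃ v : S → ToDual G S →L[ℂ] ℂ, (∀ s, ‖v s‖ ≤ 1) ∧
      (∀ g s T, v (g • s) T = v s (T.comp (act G G (basisVec g)))) ∧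
      ∀ s c T, (∀ k, T (basisVec k) (basisVec (k⁻¹ • s)) = c) → v s T = c := by
  choose m hm_norm hm_one hm using hamen
  have key (x : S) (hx : x ∈ I) (t t' : G) (h : t • x = t' • x)
      (T : ToDual G S) :
      m x hx (cosetSample (MulAction.stabilizer G x) t' x T) =
        m x hx (cosetSample (MulAction.stabilizer G x) t x T) := by
    have hk : t⁻¹ * t' ∈ MulAction.stabilizer G x := by
      rw [MulAction.mem_stabilizer_iff, mul_smul, ← h, inv_smul_smul]
    have e := cosetSample_mul (MulAction.stabilizer G x) t ⟨t⁻¹ * t', hk⟩ x T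
    rw [mul_inv_cancel_left] at e
    rw [e, hm]
  -- The formula is recorded for every representative `t`, not only the chosen one, so that `g * t`
  -- can serve for `g • s` below.
  have hv (s : S) : ∃ v : ToDual G S →L[ℂ] ℂ, ‖v‖ ≤ 1 ∧
      ∀ x (hx : x ∈ I) (t : G), t • x = s →
        ∀ T, v T = m x hx (cosetSample (MulAction.stabilizer G x) t x T) := by
    obtain ⟨x, ⟨hx, t, ht⟩, hu⟩ := hI s
    refine ⟨(m x hx).comp (cosetSample (MulAction.stabilizer G x) t x), ?_, ?_⟩
    · refine (ContinuousLinearMap.opNorm_comp_le _ _).trans ?_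
      rw [hm_norm, one_mul]
      exact norm_cosetSample_le _ _ _
    · intro x' hx' t' ht' T
      obtain rfl : x' = x := hu x' ⟨hx', t', ht'⟩
      exact key x' hx _ _ (ht'.trans ht.symm) T
  choose v hv_norm hv using hv
  refine ⟨v, hv_norm, fun g s T => ?_, fun s c T hT => ?_⟩
  · obtain ⟨x, ⟨hx, t, rfl⟩, -⟩ := hI s
    rw [hv _ x hx (g * t) (mul_smul _ _ _), hv _ x hx t rfl]
    congr 1
    ext h
    simp [cosetSample_apply, act_basisVec_basisVec, mul_assoc]
  · obtain ⟨x, ⟨hx, t, rfl⟩, -⟩ := hI s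
    rw [hv _ x hx t rfl]
    -- For `k = t * h` with `h` in the stabilizer, `k⁻¹ • (t • x) = x`, so the hypothesis on `T`
    -- makes the sample constant.
    have e : cosetSample (MulAction.stabilizer G x) t x T = c • 1 := by
      ext h
      have hh : (h : G)⁻¹ • x = x := MulAction.mem_stabilizer_iff.mp (inv_mem h.2)
      have := hT (t * h)
      simp only [mul_inv_rev, mul_smul, inv_smul_smul, hh] at this
      rw [cosetSample_apply, this]
      simp
    rw [e, map_smul, hm_one, smul_eq_mul, mul_one]

/-- If all stabilizers are amenable, the bimodule map `ℓ¹(S)' → L(ℓ¹(G), ℓ¹(S)')`, `φ ↦ (k ↦ φ · k)`,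
has a bounded left inverse which is compatible with the right actions. -/
theorem exists_averaging_operator (I : Set S)
    (hI : ∀ s : S, ∃! x : S, x ∈ I ∧ s ∈ MulAction.orbit G x)
    (hamen : ∀ x ∈ I, IsAmenableGroup (MulAction.stabilizer G x)) :
    ∃ R : ToDual G S →L[ℂ] EllOne S →L[ℂ] ℂ,
      (∀ a T, R (T.comp (act G G a)) = (bimodule G S).dual.right a (R T)) ∧
      ∀ φ, R ((bimodule G S).dual.right.flip φ) = φ := by
  obtain ⟨v, hv_norm, hv_smul, hv_const⟩ := exists_equivariant_averages I hI hamen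
  refine ⟨(lift v hv_norm).flip, fun a T => ?_, fun φ => ?_⟩
  · refine clm_ext fun s => ?_
    -- With `s` fixed, both sides are bounded and linear in `a`, so it is enough to take `a = e_g`,
    -- where equivariance of `v` applies.
    have h : (lift v hv_norm (basisVec s)).comp
          ((ContinuousLinearMap.compL ℂ (EllOne G) (EllOne G) (EllOne S →L[ℂ] ℂ) T).comp
            (act G G)) =
        ((lift v hv_norm).flip T).comp ((act G S).flip (basisVec s)) := by
      refine clm_ext fun g => ?_
      simp [act_basisVec_basisVec, hv_smul]
    exact congrArg (fun L => L a) h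
  · refine clm_ext fun s => ?_
    rw [ContinuousLinearMap.flip_apply, lift_basisVec]
    refine hv_const s _ _ fun k => ?_
    change φ (act G S (basisVec k) (basisVec (k⁻¹ • s))) = _
    rw [act_basisVec_basisVec, smul_inv_smul]

end EllOne

/-! ### Contracting the Hochschild complex by a retraction. -/

section Hochschild

theorem mulAdjacent_castSucc_snoc {A : Type*} [NormedRing A] {m : ℕ} (j : Fin m) (a : Fin (m + 1) → A) (k : A) :
    mulAdjacent j.castSucc (Fin.snoc a k : Fin (m + 2) → A) =
      Fin.snoc (mulAdjacent j a) k := by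
  funext i
  induction i using Fin.lastCases with
  | last =>
    have h1 : ¬ Fin.last m < j.castSucc := by grind
    have h2 : Fin.last m ≠ j.castSucc := by grind
    simp [mulAdjacent, h1, h2]
  | cast i =>
    rw [Fin.snoc_castSucc]
    simp only [mulAdjacent, Fin.castSucc_lt_castSucc_iff, Fin.castSucc_inj, Fin.snoc_castSucc,
      Fin.succ_castSucc]

/-- This is the one inner face that involves the free argument `k`; in `L(A, M)` it becomes the
right action `T ↦ T(a ·)` by the last entry of `a`. -/
theorem mulAdjacent_last_snoc {A : Type*} [NormedRing A] {m : ℕ} (a : Fin (m + 1) → A) (k : A) :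
    mulAdjacent (Fin.last m) (Fin.snoc a k : Fin (m + 2) → A) =
      Fin.snoc (fun i : Fin m => a i.castSucc) (a (Fin.last m) * k) := by
  funext i
  induction i using Fin.lastCases with
  | last => simp [mulAdjacent]
  | cast i => simp [mulAdjacent, Fin.castSucc_lt_last]

variable {A : Type*} [NormedRing A] [NormedAlgebra ℂ A]
  {M : Type*} [NormedAddCommGroup M] [NormedSpace ℂ M]

/-- A bounded left inverse of `φ ↦ (k ↦ φ · k)`, compatible with both actions, contracts the
Hochschild complex in positive degrees. -/
theorem hochschildCocycles_le_range (X : BanachBimodule A M) (R : (A →L[ℂ] M) →L[ℂ] M)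
    (hleft : ∀ a T, R ((X.left a).comp T) = X.left a (R T))
    (hright : ∀ a T, R (T.comp (ContinuousLinearMap.mul ℂ A a)) = X.right a (R T))
    (hR : ∀ φ, R (X.right.flip φ) = φ) (m : ℕ) :
    hochschildCocycles X (m + 1) ≤ LinearMap.range (hochschildD X m) := by
  intro f hf
  let F := ContinuousMultilinearMap.curryRight f
  have hF (b : Fin m → A) (k : A) : F b k = f (Fin.snoc b k) := rfl
  let φ : HochschildCochain A M m := R.compContinuousMultilinearMap F
  refine ⟨(-1 : ℂ) ^ (m + 1) • φ, ?_⟩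
  ext a
  -- The cocycle identity at `(a, k)`, read as an identity in `L(A, M)`: all but the last term form
  -- the coboundary of `F`, and the last is the embedded image of `f a`.
  have h : (X.left (a 0)).comp (F fun i => a i.succ)
      + ∑ j : Fin m, (-1 : ℂ) ^ ((j : ℕ) + 1) • F (mulAdjacent j a)
      + (-1 : ℂ) ^ (m + 1) • (F fun i => a i.castSucc).comp
          (ContinuousLinearMap.mul ℂ A (a (Fin.last m)))
      + (-1 : ℂ) ^ (m + 2) • X.right.flip (f a) = 0 := by
    ext k
    have h0 : hochschildD X (m + 1) f (Fin.snoc a k) = 0 := by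
      rw [LinearMap.mem_ker.mp hf]; rfl
    rw [hochschildD_apply, Fin.sum_univ_castSucc] at h0
    have e : (fun i : Fin (m + 1) => (Fin.snoc a k : Fin (m + 2) → A) i.succ) =
        Fin.snoc (fun i : Fin m => a i.succ) k := by
      funext i
      induction i using Fin.lastCases with
      | last => simp
      | cast i => simp [Fin.succ_castSucc, -Fin.castSucc_succ]
    have e0 : (Fin.snoc a k : Fin (m + 2) → A) 0 = a 0 := Fin.snoc_castSucc (α := fun _ => A) k a 0
    simp only [mulAdjacent_castSucc_snoc, mulAdjacent_last_snoc, e, e0, Fin.snoc_last,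
      Fin.snoc_castSucc, Fin.val_castSucc, Fin.val_last] at h0
    simpa [hF, add_assoc] using h0
  have h' := congrArg R h
  simp only [map_add, map_sum, map_smul, hleft, hright, hR, map_zero] at h'
  rw [map_smul, smul_apply, hochschildD_apply]
  change (-1 : ℂ) ^ (m + 1) • (X.left (a 0) (R (F fun i => a i.succ))
    + ∑ j : Fin m, (-1 : ℂ) ^ ((j : ℕ) + 1) • R (F (mulAdjacent j a))
    + (-1 : ℂ) ^ (m + 1) • X.right (a (Fin.last m)) (R (F fun i => a i.castSucc))) = f a
  -- After `R` is applied, the coboundary of `φ` at `a` equals `-(-1)^(m+2) • f a`; the prefactor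
  -- `(-1)^(m+1)` cancels this sign.
  rw [eq_neg_of_add_eq_zero_left h', ← neg_smul, smul_smul]
  convert one_smul ℂ (f a)
  rw [pow_succ _ (m + 1), mul_neg_one, neg_neg, ← mul_pow]
  simp

end Hochschild

end

theorem mainTheorem3 {G S : Type*} [Group G] [MulAction G S]
    (I : Set S) (hI : ∀ s : S, ∃! x : S, x ∈ I ∧ s ∈ MulAction.orbit G x)
    (hamen : ∀ x ∈ I, IsAmenableGroup (MulAction.stabilizer G x))
    (n : ℕ) (hn : 1 ≤ n) :
    Subsingleton (HochschildCohomology (EllOne.bimodule G S).dual n) := by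
  obtain ⟨m, rfl⟩ : ∃ m, n = m + 1 := ⟨n - 1, by omega⟩
  obtain ⟨R, hright, hR⟩ := EllOne.exists_averaging_operator I hI hamen
  rw [Submodule.Quotient.subsingleton_iff, Submodule.submoduleOf_eq_top]
  refine hochschildCocycles_le_range _ R (fun a T => ?_) hright hR m
  -- Because the right action on `ℓ¹(S)` is by augmentation, the dual left action is scalar, and any
  -- linear `R` respects it.
  have hleft (φ : EllOne S →L[ℂ] ℂ) :
      (EllOne.bimodule G S).dual.left a φ = EllOne.augmentation G a • φ := by
    ext u
    simp [BanachBimodule.dual_left_apply, EllOne.bimodule]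
  have e : ((EllOne.bimodule G S).dual.left a).comp T = EllOne.augmentation G a • T := by
    ext1 k
    exact hleft (T k)
  rw [e, map_smul, hleft]
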